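/- Let $\mathcal H_A=\mathbb C^d$, let $\mathbf M=\{M_1,\dots,M_m\}$ be a POVM on $\mathcal H_A$ (positive semidefinite operators with $\sum_i M_i=\mathbf 1$), and let $\rho$ be a density operator on $\mathcal H_A$. A PVM is a POVM whose elements are projections. A generalized Naimark extension $\{\mathbf P,\sigma\}$ of $\mathbf M$ consists of a finite-dimensional ancillary space $\mathcal H_Q$, a possibly mixed state $\sigma$ on $\mathcal H_Q$, and a PVM $\mathbf P=\{P_1,\dots,P_m\}$ on $\mathcal H_A\otimes\mathcal H_Q$ such that $M_i=\operatorname{tr}_Q[P_i(\mathbf 1\otimes\sigma)]$ for all $i$. The POVM $\mathbf M$ is extremal if $\mathbf M=\lambda\mathbf M'+(1-\lambda)\mathbf M''$ with POVMs $\mathbf M',\mathbf M''$ and $0<\lambda<1$ implies $\mathbf M'=\mathbf M''=\mathbf M$. For a PVM $\mathbf P$ and a state $\varrho$ put $\Delta_{\mathbf P}(\varrho)=\sum_i P_i\varrho P_i$ and $$R_c(\varrho,\mathbf P)=\min_{\{q_j,|\psi_j\rangle\}}\sum_j q_j\,S\big(\Delta_{\mathbf P}(|\psi_j\rangle\langle\psi_j|)\big),\qquad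 R_q(\varrho,\mathbf P)=S\big(\varrho\,\|\,\Delta_{\mathbf P}(\varrho)\big),$$ where the minimum is over the finite pure-state decompositions $\varrho=\sum_j q_j|\psi_j\rangle\langle\psi_j|$ (unit vectors $|\psi_j\rangle$, $q_j\ge0$, $\sum_jq_j=1$), $S(\varrho)=-\operatorname{tr}(\varrho\log_2\varrho)$ is the von Neumann entropy, and $S(\varrho\|\tau)=\operatorname{tr}(\varrho\log_2\varrho-\varrho\log_2\tau)$ is the quantum relative entropy. For $R\in\{R_c,R_q\}$ let $R(\rho,\mathbf M)=\min_{\mathbf P,\sigma}R(\rho\otimes\sigma,\mathbf P)$, the minimum being over all generalized Naimark extensions $\{\mathbf P,\sigma\}$ of $\mathbf M$. Theorem. Let $\mathbf M$ be extremal and let $R=R_c$ or $R=R_q$. Then $R(\rho\otimes\sigma_1,\mathbf P_1)=R(\rho\otimes\sigma_2,\mathbf P_2)$ for any two generalized Naimark extensions $\{\mathbf P_1,\sigma_1\}$ and $\{\mathbf P_2,\sigma_2\}$ of $\mathbf M$. Moreover, $\mathbf M$ has a canonical extension, that is, a generalized Naimark extension $\{\mathbf P_c,|0\rangle\langle0|\}$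 whose ancillary space is $m$-dimensional with an orthonormal basis that is labelled by the $m$ outcomes and contains $|0\rangle$ as one of its vectors (for any choice of the label of $|0\rangle$), and in which the projection for outcome $i$ is $U^\dagger(\mathbf 1\otimes|i\rangle\langle i|)U$ for a unitary $U$; the minimum that defines $R(\rho,\mathbf M)$ is attained, and for every canonical extension $$R(\rho,\mathbf M)=R(\rho\otimes|0\rangle\langle0|,\mathbf P_c).$$ -/

import Mathlib

open scoped Kronecker ComplexOrder

noncomputable section

namespace QRand

/-! Finite-dimensional quantum systems: the Hilbert space with orthonormal basis indexed by a finite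
type `d` is `ℂ^d`, its operators are `Matrix d d ℂ`, and the joint system `A ⊗ Q` is indexed by
`d × q`. -/

variable {d ι q : Type*} [Fintype d] [DecidableEq d] [Fintype ι] [Fintype q] [DecidableEq q]

/-- Density operators: positive semidefinite with unit trace. -/
def IsState (ρ : Matrix d d ℂ) : Prop :=
  ρ.PosSemidef ∧ ρ.trace = 1

/-- Unit vectors. -/
def IsUnitVector (ψ : d → ℂ) : Prop :=
  star ψ ⬝ᵥ ψ = 1

/-- The rank-one operator `|ψ⟩⟨ψ|`. -/
def ketbra (ψ : d → ℂ) : Matrix d d ℂ :=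
  Matrix.vecMulVec ψ (star ψ)

/-- The basis vector `|i⟩`. -/
def ket [DecidableEq ι] (i : ι) : ι → ℂ :=
  Pi.single i 1

/-- A POVM with outcomes in `ι`: positive semidefinite operators that sum to the identity. -/
def IsPOVM (M : ι → Matrix d d ℂ) : Prop :=
  (∀ i, (M i).PosSemidef) ∧ ∑ i, M i = 1

/-- A PVM: a POVM all of whose elements are projections. -/
def IsPVM (P : ι → Matrix d d ℂ) : Prop :=
  IsPOVM P ∧ ∀ i, P i * P i = P i

/-- An extremal POVM: it is no proper mixture of two POVMs other than itself. -/
def IsExtremalPOVM (M : ι → Matrix d d ℂ) : Prop :=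
  IsPOVM M ∧ ∀ (M' M'' : ι → Matrix d d ℂ) (t : ℝ), IsPOVM M' → IsPOVM M'' → 0 < t → t < 1 →
    (∀ i, M i = (t : ℂ) • M' i + ((1 - t : ℝ) : ℂ) • M'' i) → M' = M ∧ M'' = M

/-- The partial trace over the second system. -/
def partialTraceQ (X : Matrix (d × q) (d × q) ℂ) : Matrix d d ℂ :=
  Matrix.of fun a b => ∑ k, X (a, k) (b, k)

/-- A generalized Naimark extension `{P, σ}` of `M`: a PVM `P` on `A ⊗ Q`, with the outcomes of `M`,
and a possibly mixed ancillary state `σ` on `Q`, with `M i = tr_Q [P i (1 ⊗ σ)]`. -/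
def IsNaimarkExtension (M : ι → Matrix d d ℂ) (P : ι → Matrix (d × q) (d × q) ℂ)
    (σ : Matrix q q ℂ) : Prop :=
  IsPVM P ∧ IsState σ ∧ ∀ i, M i = partialTraceQ (P i * ((1 : Matrix d d ℂ) ⊗ₖ σ))

/-- `P` is the PVM of a canonical Naimark extension of `M` whose ancillary state is `|i₀⟩⟨i₀|`: the
ancilla `ℂ^ι` has one basis vector for each outcome, and `P i = U† (1 ⊗ |i⟩⟨i|) U` for a unitary `U`
such that `M i = tr_Q [P i (1 ⊗ |i₀⟩⟨i₀|)]`. -/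
def IsCanonicalExtension [DecidableEq ι] (M : ι → Matrix d d ℂ) (i₀ : ι)
    (P : ι → Matrix (d × ι) (d × ι) ℂ) : Prop :=
  (∃ U ∈ Matrix.unitaryGroup (d × ι) ℂ,
    ∀ i, P i = star U * ((1 : Matrix d d ℂ) ⊗ₖ ketbra (ket i)) * U) ∧
  ∀ i, M i = partialTraceQ (P i * ((1 : Matrix d d ℂ) ⊗ₖ ketbra (ket i₀)))

/-- The base-two logarithm of a Hermitian operator, by functional calculus; it is zero on the
kernel, which gives the convention `0 log 0 = 0`. -/
def log₂ (A : Matrix d d ℂ) : Matrix d d ℂ :=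
  cfc (Real.logb 2) A

/-- The von Neumann entropy `S(ρ) = -tr (ρ log ρ)`. -/
def vonNeumannEntropy (ρ : Matrix d d ℂ) : ℝ :=
  -(ρ * log₂ ρ).trace.re

/-- The quantum relative entropy `S(ρ‖τ) = tr (ρ log ρ - ρ log τ)` of states with
`ker τ ⊆ ker ρ`; the lemma `ker_dephase` says that this holds for `τ = Δ_P(ρ)`. -/
def relEntropy (ρ τ : Matrix d d ℂ) : ℝ :=
  (ρ * log₂ ρ - ρ * log₂ τ).trace.re

/-- The block-dephasing operation `Δ_P(ρ) = ∑ i, P i ρ P i`. -/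
def dephase (P : ι → Matrix d d ℂ) (ρ : Matrix d d ℂ) : Matrix d d ℂ :=
  ∑ i, P i * ρ * P i

/-- The kernel of `Δ_P(ρ)` is contained in that of `ρ`, so that `S(ρ‖Δ_P(ρ))` is finite. -/
theorem ker_dephase {P : ι → Matrix d d ℂ} {ρ : Matrix d d ℂ} (hP : IsPVM P)
    (hρ : ρ.PosSemidef) (v : d → ℂ) (hv : (dephase P ρ).mulVec v = 0) : ρ.mulVec v = 0 := by
  have hH : ∀ i, (P i).conjTranspose = P i := fun i => (hP.1.1 i).isHermitian.eq
  have hpsd : ∀ i, (P i * ρ * P i).PosSemidef := fun i => by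
    simpa only [hH i] using hρ.mul_mul_conjTranspose_same (P i)
  have hsum : ∑ i, star v ⬝ᵥ (P i * ρ * P i).mulVec v = 0 := by
    rw [← dotProduct_sum, ← Matrix.sum_mulVec]
    simp only [dephase] at hv
    rw [hv, dotProduct_zero]
  have hz : ∀ i, ρ.mulVec ((P i).mulVec v) = 0 := by
    intro i
    have h0 := (Finset.sum_eq_zero_iff_of_nonneg
      (fun i _ => (hpsd i).dotProduct_mulVec_nonneg v)).1 hsum i (Finset.mem_univ i)
    rw [← hρ.dotProduct_mulVec_zero_iff, ← h0, Matrix.star_mulVec, hH i, ← Matrix.dotProduct_mulVec,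
      Matrix.mulVec_mulVec, Matrix.mulVec_mulVec, Matrix.mul_assoc]
  have h1 : v = ∑ i, (P i).mulVec v := by
    rw [← Matrix.sum_mulVec, hP.1.2, Matrix.one_mulVec]
  rw [h1, Matrix.mulVec_sum]
  exact Finset.sum_eq_zero fun i _ => hz i

/-- A finite pure-state decomposition `ρ = ∑ j, w j |ψ j⟩⟨ψ j|`. -/
def IsPureDecomposition {k : ℕ} (ρ : Matrix d d ℂ) (w : Fin k → ℝ) (ψ : Fin k → d → ℂ) : Prop :=
  (∀ j, 0 ≤ w j) ∧ ∑ j, w j = 1 ∧ (∀ j, IsUnitVector (ψ j)) ∧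
    ρ = ∑ j, (w j : ℂ) • ketbra (ψ j)

/-- `R_c(ρ, P)`: the convex roof, that is the minimum of `∑ j, w j S(Δ_P(|ψ j⟩⟨ψ j|))` over all
pure-state decompositions of `ρ`. -/
def Rc (ρ : Matrix d d ℂ) (P : ι → Matrix d d ℂ) : ℝ :=
  sInf {r : ℝ | ∃ (k : ℕ) (w : Fin k → ℝ) (ψ : Fin k → d → ℂ), IsPureDecomposition ρ w ψ ∧
    r = ∑ j, w j * vonNeumannEntropy (dephase P (ketbra (ψ j)))}

/-- `R_q(ρ, P) = S(ρ‖Δ_P(ρ))`. -/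
def Rq (ρ : Matrix d d ℂ) (P : ι → Matrix d d ℂ) : ℝ :=
  relEntropy ρ (dephase P ρ)

/-- The two randomness functions. -/
inductive RandomnessKind
  | c
  | q

/-- The randomness `R(ρ, P)` of a PVM, for `R = R_c` or `R = R_q`. -/
def randomness (R : RandomnessKind) (ρ : Matrix d d ℂ) (P : ι → Matrix d d ℂ) : ℝ :=
  match R with
  | .c => Rc ρ P
  | .q => Rq ρ P

/-- The values `R(ρ ⊗ σ, P)` over all generalized Naimark extensions `{P, σ}` of `M`, with ancillas
`ℂ^n` of every finite dimension. -/
def extensionValues (R : RandomnessKind) (ρ : Matrix d d ℂ) (M : ι → Matrix d d ℂ) : Set ℝ :=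
  {r : ℝ | ∃ (n : ℕ) (P : ι → Matrix (d × Fin n) (d × Fin n) ℂ) (σ : Matrix (Fin n) (Fin n) ℂ),
    IsNaimarkExtension M P σ ∧ r = randomness R (ρ ⊗ₖ σ) P}

/-- The intrinsic randomness `R(ρ, M)`: the minimum of `R(ρ ⊗ σ, P)` over all generalized Naimark
extensions `{P, σ}` of `M`. -/
def intrinsicRandomness (R : RandomnessKind) (ρ : Matrix d d ℂ) (M : ι → Matrix d d ℂ) : ℝ :=
  sInf (extensionValues R ρ M)

end QRand

end

set_option linter.unusedSectionVars false

/-! Extremality makes the ancilla invisible. If `0 ≤ X ≤ σ`, splitting `σ` into `X / 2` and `σ - X /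
2` writes `M` as a mixture of two POVMs, so each must be `M` itself: `tr_Q [P i (1 ⊗ X)] = tr X • M
i` (`partialTraceQ_of_le`). With `σ = s s†` and `X = s |c⟩⟨c| s†` for all unit `c`, polarization
upgrades this to the operator identity `(1 ⊗ s†) P i (1 ⊗ s) = M i ⊗ s† s` (`compression_eq`): on
the support of `σ` the measurement `P` acts as `M ⊗ 1`.

Both randomness functions then depend on `ρ` and `M` alone. For `R_q`, write `ρ = r r†` and `Y = r ⊗
s`. The relative entropy involves only `Y Y†` and the operators `Y† P i Y = r† M i r ⊗ s† s`; `tr A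
log A` obeys a product rule on tensor products, and the contributions of `σ` cancel
(`Rq_naimarkExtension`). For `R_c`, the vectors in a decomposition of `ρ ⊗ σ` lie in the support, so
their outcome statistics are those of `M` on the reduced state. Product decompositions and concavity
of the Shannon entropy identify `R_c` with the convex roof of the outcome entropy of `M`
(`Rc_naimarkExtension`). -/

namespace QRand

/-! ### Functional calculus and the trace of `A log A`. -/

section

/-- Functional calculus respects intertwiners of Hermitian matrices. -/
theorem cfc_mul_of_intertwines {m n : Type*} [Fintype m] [DecidableEq m] [Fintype n]
    [DecidableEq n] (f : ℝ → ℝ) {A : Matrix m m ℂ} {B : Matrix n n ℂ} (hA : A.IsHermitian)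
    (hB : B.IsHermitian) {X : Matrix m n ℂ} (h : A * X = X * B) :
    cfc f A * X = X * cfc f B := by
  classical
  have hfin : (spectrum ℝ A ∪ spectrum ℝ B).Finite :=
    Matrix.finite_real_spectrum.union Matrix.finite_real_spectrum
  -- Both spectra are finite, so one interpolating polynomial represents `f` on `A` and `B`
  -- simultaneously; polynomials pass through `X` by induction on powers.
  set p : Polynomial ℝ := Lagrange.interpolate hfin.toFinset id f
  have hp : ∀ x ∈ spectrum ℝ A ∪ spectrum ℝ B, f x = p.eval x := fun x hx =>
    (Lagrange.eval_interpolate_at_node f (Set.injOn_id _) (hfin.mem_toFinset.2 hx)).symm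
  rw [cfc_congr (f := f) (g := p.eval) (a := A) fun x hx => hp x (Or.inl hx),
    cfc_congr (f := f) (g := p.eval) (a := B) fun x hx => hp x (Or.inr hx),
    cfc_polynomial p A hA.isSelfAdjoint, cfc_polynomial p B hB.isSelfAdjoint]
  induction p using Polynomial.induction_on' with
  | add p q hp hq => simp [Matrix.add_mul, Matrix.mul_add, *]
  | monomial k c =>
    have hk : A ^ k * X = X * B ^ k := by
      induction k with
      | zero => simp
      | succ k ih => rw [pow_succ, Matrix.mul_assoc, h, ← Matrix.mul_assoc, ih, Matrix.mul_assoc,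
          ← pow_succ]
    simp [Polynomial.aeval_monomial, Algebra.algebraMap_eq_smul_one, hk]

/-- `tr (A log A)`. -/
noncomputable def trMulLog {n : Type*} [Fintype n] [DecidableEq n] (A : Matrix n n ℂ) : ℂ :=
  (A * log₂ A).trace

variable {m n : Type*} [Fintype m] [DecidableEq m] [Fintype n] [DecidableEq n]

/-- `Y†` intertwines `Y Y†` with `Y† Y`; these share their nonzero eigenvalues, and zero contributes
nothing. -/
theorem trMulLog_mul_conjTranspose (Y : Matrix m n ℂ) :
    trMulLog (Y * Y.conjTranspose) = trMulLog (Y.conjTranspose * Y) := by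
  have h := cfc_mul_of_intertwines (Real.logb 2) (Matrix.isHermitian_conjTranspose_mul_self Y)
    (Matrix.isHermitian_mul_conjTranspose_self Y) (X := Y.conjTranspose)
    (Matrix.mul_assoc _ _ _)
  rw [trMulLog, trMulLog, log₂, log₂, Matrix.mul_assoc, ← h, Matrix.trace_mul_comm,
    Matrix.mul_assoc, Matrix.trace_mul_comm]

theorem isHermitian_diagonal_ofReal (a : n → ℝ) :
    (Matrix.diagonal fun i => (a i : ℂ)).IsHermitian :=
  Matrix.isHermitian_diagonal_of_self_adjoint _ (by ext i; simp)

theorem cfc_diagonal (f : ℝ → ℝ) (a : n → ℝ) :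
    cfc f (Matrix.diagonal fun i => (a i : ℂ)) = Matrix.diagonal fun i => (f (a i) : ℂ) := by
  ext i j
  -- The `j`-th basis column is an eigenvector: it intertwines the diagonal matrix with the `1 × 1`
  -- matrix `a j`.
  have h := cfc_mul_of_intertwines f (isHermitian_diagonal_ofReal a) (B := algebraMap ℝ (Matrix Unit Unit ℂ) (a j))
    (X := Matrix.single j () 1) (IsSelfAdjoint.algebraMap _ (IsSelfAdjoint.all _)) (by
      ext k l
      by_cases hk : j = k <;>
        simp [Matrix.single, Matrix.mul_apply, Matrix.algebraMap_matrix_apply, hk, eq_comm])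
  rw [cfc_algebraMap] at h
  have h' := congrFun (congrFun h i) ()
  by_cases hk : j = i <;>
    simpa [Matrix.single, Matrix.mul_apply, Matrix.algebraMap_matrix_apply, Matrix.diagonal_apply, hk,
      Ne.symm, eq_comm] using h'

theorem trMulLog_diagonal (a : n → ℝ) :
    trMulLog (Matrix.diagonal fun i => (a i : ℂ)) = ∑ i, ((a i * Real.logb 2 (a i) : ℝ) : ℂ) := by
  simp [trMulLog, log₂, cfc_diagonal, Matrix.diagonal_mul_diagonal, Matrix.trace_diagonal]

theorem trMulLog_unitary_conj {A : Matrix n n ℂ} (hA : A.IsHermitian) {U : Matrix n n ℂ}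
    (hU : U ∈ Matrix.unitaryGroup n ℂ) :
    trMulLog (U * A * star U) = trMulLog A := by
  have hU1 := Matrix.mem_unitaryGroup_iff'.1 hU
  have hH : (U * A * star U).IsHermitian := Matrix.isHermitian_mul_mul_conjTranspose U hA
  have h := cfc_mul_of_intertwines (Real.logb 2) hH hA (X := U) (by
    rw [Matrix.mul_assoc, hU1, Matrix.mul_one])
  rw [trMulLog, trMulLog, log₂, log₂, Matrix.mul_assoc, Matrix.mul_assoc, Matrix.trace_mul_comm,
    Matrix.mul_assoc, Matrix.mul_assoc, h, ← Matrix.mul_assoc (star U), hU1, Matrix.one_mul]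

theorem exists_unitary_diagonal {A : Matrix n n ℂ} (hA : A.IsHermitian) :
    ∃ U ∈ Matrix.unitaryGroup n ℂ, ∃ a : n → ℝ,
      A = U * Matrix.diagonal (fun i => (a i : ℂ)) * star U :=
  ⟨_, hA.eigenvectorUnitary.2, hA.eigenvalues, by
    conv_lhs => rw [hA.spectral_theorem, Unitary.conjStarAlgAut_apply]
    rfl⟩

/-- After diagonalizing, this is `ab log (ab) = ab log a + ab log b`. It also holds at zero because
of the prefactor, and for negative eigenvalues because `Real.logb` depends only on the absolute
value. -/
theorem trMulLog_kronecker {A : Matrix m m ℂ} {B : Matrix n n ℂ} (hA : A.IsHermitian)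
    (hB : B.IsHermitian) :
    trMulLog (A ⊗ₖ B) = trMulLog A * B.trace + A.trace * trMulLog B := by
  obtain ⟨U, hU, a, rfl⟩ := exists_unitary_diagonal hA
  obtain ⟨V, hV, b, rfl⟩ := exists_unitary_diagonal hB
  have hUV : U ⊗ₖ V ∈ Matrix.unitaryGroup (m × n) ℂ := Matrix.kronecker_mem_unitary hU hV
  have hD : (Matrix.diagonal (fun i => (a i : ℂ)) ⊗ₖ Matrix.diagonal fun j => (b j : ℂ))
      = Matrix.diagonal fun k : m × n => ((a k.1 * b k.2 : ℝ) : ℂ) := by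
    simp [Matrix.diagonal_kronecker_diagonal]
  have hstar : star (U ⊗ₖ V) = star U ⊗ₖ star V := Matrix.conjTranspose_kronecker U V
  rw [Matrix.mul_kronecker_mul, Matrix.mul_kronecker_mul, ← hstar, hD,
    trMulLog_unitary_conj (isHermitian_diagonal_ofReal _) hUV,
    trMulLog_unitary_conj (isHermitian_diagonal_ofReal _) hU,
    trMulLog_unitary_conj (isHermitian_diagonal_ofReal _) hV,
    Matrix.trace_mul_cycle V, Matrix.mem_unitaryGroup_iff'.1 hV, Matrix.one_mul,
    Matrix.trace_mul_cycle U, Matrix.mem_unitaryGroup_iff'.1 hU, Matrix.one_mul,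
    trMulLog_diagonal, trMulLog_diagonal, trMulLog_diagonal, Matrix.trace_diagonal,
    Matrix.trace_diagonal, Fintype.sum_prod_type, Finset.sum_mul_sum, Finset.sum_mul_sum,
    ← Finset.sum_add_distrib]
  refine Finset.sum_congr rfl fun i _ => ?_
  rw [← Finset.sum_add_distrib]
  refine Finset.sum_congr rfl fun j _ => ?_
  rcases eq_or_ne (a i) 0 with hi | hi
  · simp [hi]
  rcases eq_or_ne (b j) 0 with hj | hj
  · simp [hj]
  rw [Real.logb_mul hi hj]
  push_cast
  ring

end

/-! ### Projective measurements, dephasing, and entropies of the blocks. -/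

section

variable {d ι : Type*} [Fintype d] [DecidableEq d] [Fintype ι]

theorem IsPVM.isHermitian {P : ι → Matrix d d ℂ} (hP : IsPVM P) (i : ι) : (P i).IsHermitian :=
  (hP.1.1 i).isHermitian

/-- Compressing `∑ k, P k = 1` by `P j` shows that the nonnegative traces of `P j * P k * P j` with
`k ≠ j` sum to zero. Each vanishes, and for `k = i` it is the squared Hilbert–Schmidt norm of `P i *
P j`. -/
theorem IsPVM.mul_eq_zero {P : ι → Matrix d d ℂ} (hP : IsPVM P) {i j : ι} (hij : i ≠ j) :
    P i * P j = 0 := by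
  classical
  have hpsd : ∀ k, (P j * P k * P j).PosSemidef := fun k => by
    simpa only [(hP.isHermitian j).eq] using (hP.1.1 k).mul_mul_conjTranspose_same (P j)
  have hsum : ∑ k ∈ Finset.univ.erase j, (P j * P k * P j).trace = 0 := by
    have h : ∑ k, (P j * P k * P j).trace = (P j).trace := by
      rw [← Matrix.trace_sum, ← Finset.sum_mul, ← Finset.mul_sum, hP.1.2, Matrix.mul_one, hP.2]
    rw [← Finset.add_sum_erase _ _ (Finset.mem_univ j), hP.2, hP.2] at h
    simpa using h
  have h0 := (Finset.sum_eq_zero_iff_of_nonneg fun k _ => (hpsd k).trace_nonneg).1 hsum i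
    (by simp [hij])
  rw [← Matrix.trace_conjTranspose_mul_self_eq_zero_iff, Matrix.conjTranspose_mul,
    (hP.isHermitian j).eq, (hP.isHermitian i).eq, Matrix.mul_assoc, ← Matrix.mul_assoc (P i), hP.2,
    ← Matrix.mul_assoc, h0]

theorem dephase_mul {P : ι → Matrix d d ℂ} (hP : IsPVM P) (ρ : Matrix d d ℂ) (i : ι) :
    dephase P ρ * P i = P i * ρ * P i := by
  rw [dephase, Finset.sum_mul, Finset.sum_eq_single i, Matrix.mul_assoc, hP.2]
  · intro j _ hj
    rw [Matrix.mul_assoc, hP.mul_eq_zero hj, Matrix.mul_zero]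
  · simp

theorem mul_dephase {P : ι → Matrix d d ℂ} (hP : IsPVM P) (ρ : Matrix d d ℂ) (i : ι) :
    P i * dephase P ρ = P i * ρ * P i := by
  rw [dephase, Finset.mul_sum, Finset.sum_eq_single i, ← Matrix.mul_assoc, ← Matrix.mul_assoc, hP.2]
  · intro j _ hj
    rw [← Matrix.mul_assoc, ← Matrix.mul_assoc, hP.mul_eq_zero hj.symm, Matrix.zero_mul,
      Matrix.zero_mul]
  · simp

theorem isHermitian_mul_mul_self {A B : Matrix d d ℂ} (hA : A.IsHermitian) (hB : B.IsHermitian) :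
    (A * B * A).IsHermitian := by
  simpa only [hA.eq] using Matrix.isHermitian_mul_mul_conjTranspose A hB

theorem isHermitian_dephase {P : ι → Matrix d d ℂ} (hP : IsPVM P) {ρ : Matrix d d ℂ}
    (hρ : ρ.IsHermitian) : (dephase P ρ).IsHermitian := by
  rw [Matrix.IsHermitian, dephase, Matrix.conjTranspose_sum]
  exact Finset.sum_congr rfl fun i _ => isHermitian_mul_mul_self (hP.isHermitian i) hρ

/-- The blocks are mutually orthogonal: `P i` intertwines the dephased operator with its `i`-th
block, so the logarithm may be taken blockwise. -/
theorem trMulLog_dephase {P : ι → Matrix d d ℂ} (hP : IsPVM P) {ρ : Matrix d d ℂ}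
    (hρ : ρ.IsHermitian) : trMulLog (dephase P ρ) = ∑ i, trMulLog (P i * ρ * P i) := by
  conv_lhs => rw [trMulLog, dephase, Finset.sum_mul, Matrix.trace_sum, ← dephase]
  refine Finset.sum_congr rfl fun i _ => ?_
  have h := cfc_mul_of_intertwines (Real.logb 2) (isHermitian_dephase hP hρ)
    (isHermitian_mul_mul_self (hP.isHermitian i) hρ) (X := P i) (by
      rw [dephase_mul hP, ← Matrix.mul_assoc, ← Matrix.mul_assoc, hP.2])
  rw [trMulLog, log₂, log₂]
  calc (P i * ρ * P i * cfc (Real.logb 2) (dephase P ρ)).trace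
      = (P i * (P i * ρ * P i * cfc (Real.logb 2) (dephase P ρ))).trace := by
        rw [← Matrix.mul_assoc, ← Matrix.mul_assoc, ← Matrix.mul_assoc, hP.2]
    _ = (P i * ρ * P i * (cfc (Real.logb 2) (dephase P ρ) * P i)).trace := by
        rw [Matrix.trace_mul_comm, Matrix.mul_assoc]
    _ = _ := by rw [h, ← Matrix.mul_assoc, Matrix.mul_assoc _ (P i) (P i), hP.2]

/-- The logarithm commutes with every `P i`, so dephasing `ρ` leaves its trace against it unchanged.
This turns the relative entropy into a difference of entropies. -/
theorem trace_mul_log_dephase {P : ι → Matrix d d ℂ} (hP : IsPVM P) {ρ : Matrix d d ℂ}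
    (hρ : ρ.IsHermitian) : (ρ * log₂ (dephase P ρ)).trace = trMulLog (dephase P ρ) := by
  have hcomm : ∀ i, log₂ (dephase P ρ) * P i = P i * log₂ (dephase P ρ) := fun i =>
    cfc_mul_of_intertwines _ (isHermitian_dephase hP hρ) (isHermitian_dephase hP hρ)
      (by rw [dephase_mul hP, mul_dephase hP])
  conv_rhs => rw [trMulLog, dephase, Finset.sum_mul, Matrix.trace_sum, ← dephase]
  have h : ∀ i, (P i * ρ * P i * log₂ (dephase P ρ)).trace
      = (P i * (ρ * log₂ (dephase P ρ))).trace := fun i => by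
    rw [Matrix.mul_assoc, ← hcomm, ← Matrix.mul_assoc, Matrix.trace_mul_comm, ← Matrix.mul_assoc,
      ← Matrix.mul_assoc, hP.2, Matrix.mul_assoc]
  simp_rw [h]
  rw [← Matrix.trace_sum, ← Finset.sum_mul, hP.1.2, Matrix.one_mul]

/-- Swapping the factors of `(P i * Y) * (P i * Y)†` trades the block for `Y† P i Y`, the operator
that extremality determines. -/
theorem trMulLog_compress {n : Type*} [Fintype n] [DecidableEq n] {P : ι → Matrix d d ℂ}
    (hP : IsPVM P) (Y : Matrix d n ℂ) (i : ι) :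
    trMulLog (P i * (Y * Y.conjTranspose) * P i) = trMulLog (Y.conjTranspose * P i * Y) := by
  have h := trMulLog_mul_conjTranspose (P i * Y)
  rw [Matrix.conjTranspose_mul, (hP.isHermitian i).eq] at h
  rw [show P i * (Y * Y.conjTranspose) * P i = P i * Y * (Y.conjTranspose * P i) by
    simp only [Matrix.mul_assoc], h, Matrix.mul_assoc, ← Matrix.mul_assoc (P i), hP.2,
    Matrix.mul_assoc]

theorem ketbra_eq (ψ : d → ℂ) :
    ketbra ψ = Matrix.replicateCol Unit ψ * (Matrix.replicateCol Unit ψ).conjTranspose := by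
  ext a b
  simp [ketbra, Matrix.vecMulVec_apply, Matrix.mul_apply]

theorem isHermitian_ketbra (ψ : d → ℂ) : (ketbra ψ).IsHermitian := by
  rw [ketbra_eq]; exact Matrix.isHermitian_mul_conjTranspose_self _

/-- The entropy of the distribution of a measurement, in bits. -/
noncomputable def shannon (p : ι → ℝ) : ℝ :=
  ∑ i, Real.negMulLog (p i) / Real.log 2

/-- The probability of an outcome `M` in the (possibly unnormalized) pure state `ψ`. -/
noncomputable def prob (M : Matrix d d ℂ) (ψ : d → ℂ) : ℝ :=
  (star ψ ⬝ᵥ M.mulVec ψ).re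

theorem coe_prob {M : Matrix d d ℂ} (hM : M.IsHermitian) (ψ : d → ℂ) :
    (prob M ψ : ℂ) = star ψ ⬝ᵥ M.mulVec ψ := by
  exact Complex.ext rfl (hM.im_star_dotProduct_mulVec_self ψ).symm

/-- Each block of a pure state has rank at most one; after the swap it is the `1 × 1` matrix holding
the outcome probability. -/
theorem vonNeumannEntropy_dephase_ketbra {P : ι → Matrix d d ℂ} (hP : IsPVM P) (ψ : d → ℂ) :
    vonNeumannEntropy (dephase P (ketbra ψ)) = shannon fun i => prob (P i) ψ := by
  rw [vonNeumannEntropy, ← trMulLog, trMulLog_dephase hP (isHermitian_ketbra ψ), shannon,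
    Complex.re_sum, ← Finset.sum_neg_distrib]
  refine Finset.sum_congr rfl fun i _ => ?_
  have hdiag : (Matrix.replicateCol Unit ψ).conjTranspose * P i * Matrix.replicateCol Unit ψ
      = Matrix.diagonal fun _ => (prob (P i) ψ : ℂ) := by
    ext
    rw [Matrix.diagonal_apply_eq, coe_prob (hP.isHermitian i), Matrix.mul_assoc,
      ← Matrix.replicateCol_mulVec]
    simp [Matrix.mul_apply, dotProduct]
  rw [ketbra_eq, trMulLog_compress hP, hdiag, trMulLog_diagonal, Fintype.sum_unique,
    Complex.ofReal_re, Real.negMulLog, Real.logb]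
  ring

theorem Rq_eq {n : Type*} [Fintype n] [DecidableEq n] {P : ι → Matrix d d ℂ}
    (hP : IsPVM P) (Y : Matrix d n ℂ) :
    Rq (Y * Y.conjTranspose) P = (trMulLog (Y * Y.conjTranspose)
      - ∑ i, trMulLog (Y.conjTranspose * P i * Y)).re := by
  have hH := Matrix.isHermitian_mul_conjTranspose_self Y
  rw [Rq, relEntropy, Matrix.trace_sub, trace_mul_log_dephase hP hH, trMulLog_dephase hP hH,
    ← trMulLog]
  simp only [trMulLog_compress hP]

end

/-! ### Partial traces and induced POVMs. -/

section

variable {d ι q : Type*} [Fintype d] [DecidableEq d] [Fintype ι] [Fintype q] [DecidableEq q]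

theorem mul_one_kronecker_apply (X : Matrix (d × q) (d × q) ℂ) (Y : Matrix q q ℂ) (a b : d)
    (k l : q) :
    (X * ((1 : Matrix d d ℂ) ⊗ₖ Y)) (a, k) (b, l) = ∑ j, X (a, k) (b, j) * Y j l := by
  simp [Matrix.mul_apply, Fintype.sum_prod_type, Matrix.kroneckerMap_apply, Matrix.one_apply]

theorem one_kronecker_mul_apply (X : Matrix (d × q) (d × q) ℂ) (Y : Matrix q q ℂ) (a b : d)
    (k l : q) :
    (((1 : Matrix d d ℂ) ⊗ₖ Y) * X) (a, k) (b, l) = ∑ j, Y k j * X (a, j) (b, l) := by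
  simp [Matrix.mul_apply, Fintype.sum_prod_type, Matrix.kroneckerMap_apply, Matrix.one_apply]

/-- Partial traces are not cyclic in general, but they are for a factor acting only on the system
traced out. -/
theorem partialTraceQ_mul_one_kronecker_comm (X : Matrix (d × q) (d × q) ℂ) (Y : Matrix q q ℂ) :
    partialTraceQ (X * ((1 : Matrix d d ℂ) ⊗ₖ Y)) = partialTraceQ (((1 : Matrix d d ℂ) ⊗ₖ Y) * X) := by
  ext a b
  simp only [partialTraceQ, Matrix.of_apply, mul_one_kronecker_apply, one_kronecker_mul_apply]
  rw [Finset.sum_comm]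
  simp only [mul_comm]

theorem partialTraceQ_add (X Y : Matrix (d × q) (d × q) ℂ) :
    partialTraceQ (X + Y) = partialTraceQ X + partialTraceQ Y := by
  ext a b
  simp [partialTraceQ, Finset.sum_add_distrib]

theorem partialTraceQ_smul (c : ℂ) (X : Matrix (d × q) (d × q) ℂ) :
    partialTraceQ (c • X) = c • partialTraceQ X := by
  ext a b
  simp [partialTraceQ, Finset.mul_sum]

theorem partialTraceQ_sum {κ : Type*} (s : Finset κ) (X : κ → Matrix (d × q) (d × q) ℂ) :
    partialTraceQ (∑ i ∈ s, X i) = ∑ i ∈ s, partialTraceQ (X i) := by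
  ext a b
  simp [partialTraceQ, Matrix.sum_apply, Finset.sum_comm (s := s)]

theorem partialTraceQ_kronecker (A : Matrix d d ℂ) (X : Matrix q q ℂ) :
    partialTraceQ (A ⊗ₖ X) = X.trace • A := by
  ext a b
  simp [partialTraceQ, Matrix.trace, Matrix.kroneckerMap_apply, Finset.mul_sum,
    mul_comm]

theorem posSemidef_partialTraceQ {X : Matrix (d × q) (d × q) ℂ} (hX : X.PosSemidef) :
    (partialTraceQ X).PosSemidef := by
  have h : partialTraceQ X = ∑ k, X.submatrix (fun a => (a, k)) fun a => (a, k) := by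
    ext a b
    simp [partialTraceQ, Matrix.sum_apply]
  rw [h]
  exact Matrix.posSemidef_sum _ fun k _ => hX.submatrix _

open scoped MatrixOrder Matrix.Norms.L2Operator in
theorem exists_eq_mul_conjTranspose {A : Matrix d d ℂ} (hA : A.PosSemidef) :
    ∃ r : Matrix d d ℂ, A = r * r.conjTranspose := by
  obtain ⟨B, hB⟩ := CStarAlgebra.nonneg_iff_eq_star_mul_self.1 hA.nonneg
  exact ⟨B.conjTranspose, by rw [Matrix.conjTranspose_conjTranspose]; exact hB⟩

/-- The POVM on the first system that a POVM on the joint system and an ancillary state induce. -/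
theorem isPOVM_partialTraceQ {P : ι → Matrix (d × q) (d × q) ℂ} (hP : IsPOVM P)
    {X : Matrix q q ℂ} (hX : IsState X) :
    IsPOVM fun i => partialTraceQ (P i * ((1 : Matrix d d ℂ) ⊗ₖ X)) := by
  refine ⟨fun i => ?_, ?_⟩
  · obtain ⟨t, ht⟩ := exists_eq_mul_conjTranspose hX.1
    have h : (1 : Matrix d d ℂ) ⊗ₖ X
        = ((1 : Matrix d d ℂ) ⊗ₖ t) * ((1 : Matrix d d ℂ) ⊗ₖ t).conjTranspose := by
      rw [Matrix.conjTranspose_kronecker, ← Matrix.mul_kronecker_mul, ht]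
      simp
    have h' : partialTraceQ (P i * ((1 : Matrix d d ℂ) ⊗ₖ X))
        = partialTraceQ (((1 : Matrix d d ℂ) ⊗ₖ t).conjTranspose * P i * ((1 : Matrix d d ℂ) ⊗ₖ t)) := by
      rw [h, Matrix.mul_assoc, ← Matrix.mul_assoc, Matrix.conjTranspose_kronecker,
        Matrix.conjTranspose_one, partialTraceQ_mul_one_kronecker_comm]
    beta_reduce
    rw [h']
    exact posSemidef_partialTraceQ ((hP.1 i).conjTranspose_mul_mul_same _)
  · rw [← partialTraceQ_sum, ← Finset.sum_mul, hP.2, Matrix.one_mul, partialTraceQ_kronecker, hX.2,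
      one_smul]

/-! ### Consequences of extremality. -/

theorem IsState.smul_inv {X : Matrix q q ℂ} (hX : X.PosSemidef) (h0 : X.trace ≠ 0) :
    IsState (X.trace⁻¹ • X) :=
  ⟨hX.smul (inv_nonneg.2 hX.trace_nonneg), by simp [Matrix.trace_smul, h0]⟩

/-- An ancillary operator dominated by the ancillary state of a generalized Naimark extension of an
extremal POVM reproduces the POVM up to its trace. -/
theorem partialTraceQ_of_le {M : ι → Matrix d d ℂ} (hM : IsExtremalPOVM M)
    {P : ι → Matrix (d × q) (d × q) ℂ} {σ : Matrix q q ℂ} (h : IsNaimarkExtension M P σ)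
    {X : Matrix q q ℂ} (hX : X.PosSemidef) (hσX : (σ - X).PosSemidef) (i : ι) :
    partialTraceQ (P i * ((1 : Matrix d d ℂ) ⊗ₖ X)) = X.trace • M i := by
  obtain ⟨hP, hσ, hMP⟩ := h
  rcases eq_or_ne X.trace 0 with h0 | h0
  · rw [hX.trace_eq_zero_iff.1 h0]
    ext; simp [partialTraceQ]
  obtain ⟨τ, hτ⟩ : ∃ τ : ℝ, X.trace = τ := ⟨_, Complex.eq_re_of_ofReal_le hX.trace_nonneg⟩
  have hτ0 : 0 < τ := by
    have := hX.trace_nonneg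
    rw [hτ] at this h0
    exact lt_of_le_of_ne (by exact_mod_cast this) (by exact_mod_cast h0.symm)
  have hτ1 : τ ≤ 1 := by
    have := hσX.trace_nonneg
    rw [Matrix.trace_sub, hσ.2, hτ] at this
    have h1 : (0 : ℝ) ≤ 1 - τ := by exact_mod_cast this
    linarith
  -- The half keeps the remainder of positive trace even for `X = σ`, so the mixing weight `τ / 2`
  -- lies strictly between 0 and 1.
  set Z := σ - (1 / 2 : ℂ) • X
  have hZ : Z.PosSemidef := by
    have : Z = (σ - X) + (1 / 2 : ℂ) • X := by simp only [Z]; module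
    rw [this]
    exact hσX.add (hX.smul (by positivity))
  have hZt : Z.trace = ((1 - τ / 2 : ℝ) : ℂ) := by
    simp [Z, Matrix.trace_sub, hσ.2, hτ]; ring
  have hZ0 : Z.trace ≠ 0 := by
    rw [hZt]; exact_mod_cast (by linarith : (1 - τ / 2) ≠ 0)
  have key := (hM.2 _ _ (τ / 2) (isPOVM_partialTraceQ hP.1 (IsState.smul_inv hX h0))
    (isPOVM_partialTraceQ hP.1 (IsState.smul_inv hZ hZ0)) (by linarith) (by linarith) fun i => by
      rw [← hZt, ← partialTraceQ_smul, ← partialTraceQ_smul, ← partialTraceQ_add, ← Matrix.mul_smul,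
        ← Matrix.mul_smul, ← Matrix.kronecker_smul, ← Matrix.kronecker_smul, ← Matrix.mul_add,
        ← Matrix.kronecker_add, smul_inv_smul₀ hZ0, hMP i]
      congr 3
      have : ((τ / 2 : ℝ) : ℂ) • X.trace⁻¹ • X = (1 / 2 : ℂ) • X := by
        rw [smul_smul, hτ]
        congr 1
        have : (τ : ℂ) ≠ 0 := by exact_mod_cast hτ0.ne'
        push_cast; field_simp
      rw [this]; simp [Z]).1
  rw [← congrFun key i, ← partialTraceQ_smul, ← Matrix.mul_smul, ← Matrix.kronecker_smul,
    smul_inv_smul₀ h0]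

theorem exists_unitVector_smul [Nonempty d] (v : d → ℂ) :
    ∃ (r : ℝ) (u : d → ℂ), 0 ≤ r ∧ IsUnitVector u ∧ v = (r : ℂ) • u := by
  rcases eq_or_ne v 0 with rfl | hv
  · obtain ⟨i⟩ := ‹Nonempty d›
    exact ⟨0, Pi.single i 1, le_rfl, by simp [IsUnitVector], by simp⟩
  · set x : EuclideanSpace ℂ d := WithLp.toLp 2 v
    have hx : x ≠ 0 := fun h => hv (by simpa [x] using h)
    have hn : (‖x‖ : ℂ) ≠ 0 := by exact_mod_cast (norm_pos_iff.2 hx).ne'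
    refine ⟨‖x‖, (‖x‖ : ℂ)⁻¹ • v, norm_nonneg _, ?_, by rw [smul_inv_smul₀ hn]⟩
    have h : star v ⬝ᵥ v = (‖x‖ : ℂ) ^ 2 := by
      have := inner_self_eq_norm_sq_to_K (𝕜 := ℂ) x
      rw [EuclideanSpace.inner_eq_star_dotProduct, dotProduct_comm] at this
      exact this
    rw [IsUnitVector, star_smul, smul_dotProduct, dotProduct_smul, h]
    simp only [star_inv₀, Complex.star_def, Complex.conj_ofReal, smul_eq_mul]
    field_simp

/-- Complex polarization: a quadratic form that vanishes on unit vectors determines a zero operator,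
with no Hermiticity needed. -/
theorem eq_zero_of_dotProduct_mulVec {G : Matrix q q ℂ}
    (h : ∀ c, IsUnitVector c → star c ⬝ᵥ G.mulVec c = 0) : G = 0 := by
  rcases isEmpty_or_nonempty q with hq | hq
  · exact Subsingleton.elim _ _
  have h0 : Matrix.toEuclideanLin G.conjTranspose = 0 := by
    rw [← inner_map_self_eq_zero]
    intro x
    obtain ⟨r, u, -, hu, hx⟩ := exists_unitVector_smul (WithLp.ofLp x)
    have := h u hu
    rw [EuclideanSpace.inner_eq_star_dotProduct, dotProduct_comm]
    simp only [Matrix.ofLp_toLpLin, Matrix.toLin'_apply, Matrix.star_mulVec,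
      Matrix.conjTranspose_conjTranspose]
    rw [← Matrix.dotProduct_mulVec, hx, Matrix.mulVec_smul, star_smul, smul_dotProduct, dotProduct_smul,
      this]
    simp
  simpa using h0

theorem posSemidef_one_sub_ketbra {c : q → ℂ} (hc : IsUnitVector c) :
    (1 - ketbra c).PosSemidef := by
  have h : ketbra c * ketbra c = ketbra c := by
    rw [ketbra, Matrix.vecMulVec_mul_vecMulVec, hc, one_smul]
  have h' : 1 - ketbra c = (1 - ketbra c) * (1 - ketbra c).conjTranspose := by
    rw [Matrix.conjTranspose_sub, (isHermitian_ketbra c).eq, Matrix.conjTranspose_one, Matrix.sub_mul,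
      Matrix.mul_sub, Matrix.mul_sub, h]
    simp
  rw [h']
  exact Matrix.posSemidef_self_mul_conjTranspose _

/-- For an extremal POVM `M` and an extension `{P, s s†}`, the compression of `P i` by `1 ⊗ s` is
`M i ⊗ s† s`. -/
theorem compression_eq {M : ι → Matrix d d ℂ} (hM : IsExtremalPOVM M)
    {P : ι → Matrix (d × q) (d × q) ℂ} {s : Matrix q q ℂ}
    (h : IsNaimarkExtension M P (s * s.conjTranspose)) (i : ι) :
    ((1 : Matrix d d ℂ) ⊗ₖ s.conjTranspose) * P i * ((1 : Matrix d d ℂ) ⊗ₖ s)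
      = M i ⊗ₖ (s.conjTranspose * s) := by
  set F := ((1 : Matrix d d ℂ) ⊗ₖ s.conjTranspose) * P i * ((1 : Matrix d d ℂ) ⊗ₖ s) with hF
  suffices H : ∀ a b, (Matrix.of fun l k => F (a, l) (b, k)) - M i a b • (s.conjTranspose * s) = 0 by
    ext ⟨a, l⟩ ⟨b, k⟩
    have := congrFun (congrFun (H a b) l) k
    simpa [sub_eq_zero] using this
  intro a b
  refine eq_zero_of_dotProduct_mulVec fun c hc => ?_
  -- Since `|c⟩⟨c| ≤ 1`, this operator is dominated by `s s†`, and its trace is the quadratic form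
  -- of `s† s` at `c`.
  have hX : (s * ketbra c * s.conjTranspose).PosSemidef :=
    (Matrix.posSemidef_vecMulVec_self_star c).mul_mul_conjTranspose_same s
  have hσX : (s * s.conjTranspose - s * ketbra c * s.conjTranspose).PosSemidef := by
    have := (posSemidef_one_sub_ketbra hc).mul_mul_conjTranspose_same s
    rwa [Matrix.mul_sub, Matrix.mul_one, Matrix.sub_mul] at this
  have key := congrFun (congrFun (partialTraceQ_of_le hM h hX hσX i) a) b
  have hF' : partialTraceQ (P i * ((1 : Matrix d d ℂ) ⊗ₖ (s * ketbra c * s.conjTranspose)))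
      = partialTraceQ (F * ((1 : Matrix d d ℂ) ⊗ₖ ketbra c)) := by
    have : (1 : Matrix d d ℂ) ⊗ₖ (s * ketbra c * s.conjTranspose)
        = ((1 : Matrix d d ℂ) ⊗ₖ s) * ((1 : Matrix d d ℂ) ⊗ₖ ketbra c)
          * ((1 : Matrix d d ℂ) ⊗ₖ s.conjTranspose) := by
      simp only [← Matrix.mul_kronecker_mul, Matrix.mul_one]
    rw [this, ← Matrix.mul_assoc, partialTraceQ_mul_one_kronecker_comm]
    simp only [hF, Matrix.mul_assoc]
  have hT : (s * ketbra c * s.conjTranspose).trace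
      = star c ⬝ᵥ (s.conjTranspose * s).mulVec c := by
    rw [Matrix.trace_mul_comm, ← Matrix.mul_assoc, ketbra, Matrix.mul_vecMulVec, Matrix.trace_vecMulVec,
      dotProduct_comm]
  rw [hF', hT] at key
  rw [Matrix.sub_mulVec, dotProduct_sub, sub_eq_zero, Matrix.smul_mulVec, dotProduct_smul,
    smul_eq_mul, mul_comm]
  refine Eq.trans ?_ (key.trans rfl)
  simp only [partialTraceQ, Matrix.of_apply, mul_one_kronecker_apply, dotProduct, Matrix.mulVec, ketbra,
    Matrix.vecMulVec_apply, Finset.mul_sum]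
  refine Finset.sum_congr rfl fun l _ => Finset.sum_congr rfl fun k _ => ?_
  simp only [Pi.star_apply]
  ring

/-- The value of `R_q` on every generalized Naimark extension of an extremal POVM. -/
theorem Rq_naimarkExtension {M : ι → Matrix d d ℂ} (hM : IsExtremalPOVM M)
    {P : ι → Matrix (d × q) (d × q) ℂ} {σ : Matrix q q ℂ} (h : IsNaimarkExtension M P σ)
    {r : Matrix d d ℂ} (hr : IsState (r * r.conjTranspose)) :
    Rq ((r * r.conjTranspose) ⊗ₖ σ) P = (trMulLog (r * r.conjTranspose)
      - ∑ i, trMulLog (r.conjTranspose * M i * r)).re := by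
  obtain ⟨s, rfl⟩ := exists_eq_mul_conjTranspose h.2.1.1
  have hY : (r * r.conjTranspose) ⊗ₖ (s * s.conjTranspose)
      = (r ⊗ₖ s) * (r ⊗ₖ s).conjTranspose := by
    rw [Matrix.conjTranspose_kronecker, Matrix.mul_kronecker_mul]
  have hK : ∀ i, (r ⊗ₖ s).conjTranspose * P i * (r ⊗ₖ s)
      = (r.conjTranspose * M i * r) ⊗ₖ (s.conjTranspose * s) := fun i => by
    have hl : (r ⊗ₖ s).conjTranspose
        = (r.conjTranspose ⊗ₖ (1 : Matrix q q ℂ)) * ((1 : Matrix d d ℂ) ⊗ₖ s.conjTranspose) := by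
      rw [Matrix.conjTranspose_kronecker, ← Matrix.mul_kronecker_mul]; simp
    have hr' : r ⊗ₖ s = ((1 : Matrix d d ℂ) ⊗ₖ s) * (r ⊗ₖ (1 : Matrix q q ℂ)) := by
      rw [← Matrix.mul_kronecker_mul]; simp
    rw [hl, hr', Matrix.mul_assoc _ _ (P i), Matrix.mul_assoc, ← Matrix.mul_assoc _ _ (r ⊗ₖ 1),
      compression_eq hM h i, ← Matrix.mul_kronecker_mul, ← Matrix.mul_kronecker_mul]
    simp [Matrix.mul_assoc]
  have hst : (s.conjTranspose * s).trace = 1 := by rw [Matrix.trace_mul_comm, h.2.1.2]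
  have hrt : ∑ i, (r.conjTranspose * M i * r).trace = 1 := by
    rw [← Matrix.trace_sum, ← Finset.sum_mul, ← Finset.mul_sum, hM.1.2, Matrix.mul_one,
      Matrix.trace_mul_comm, hr.2]
  have hH : ∀ i, (r.conjTranspose * M i * r).IsHermitian := fun i =>
    ((hM.1.1 i).conjTranspose_mul_mul_same r).isHermitian
  rw [hY, Rq_eq h.1, ← hY, trMulLog_kronecker hr.1.isHermitian h.2.1.1.isHermitian, h.2.1.2, hr.2]
  simp only [hK, fun i => trMulLog_kronecker (hH i) (Matrix.isHermitian_conjTranspose_mul_self s), hst,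
    trMulLog_mul_conjTranspose s]
  -- The traces of `r† M i r` sum to 1, so the ancilla enters both terms as the same summand and
  -- cancels.
  rw [Finset.sum_add_distrib, ← Finset.sum_mul, ← Finset.sum_mul, hrt]
  congr 1
  ring

/-! ### Pure-state decompositions and the convex roof. -/

theorem trace_ketbra (ψ : d → ℂ) : (ketbra ψ).trace = star ψ ⬝ᵥ ψ := by
  rw [ketbra, Matrix.trace_vecMulVec, dotProduct_comm]

theorem ketbra_mulVec (N : Matrix d d ℂ) (ψ : d → ℂ) :
    ketbra (N.mulVec ψ) = N * ketbra ψ * N.conjTranspose := by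
  rw [ketbra, ketbra, Matrix.mul_vecMulVec, Matrix.vecMulVec_mul, Matrix.star_mulVec]

theorem ketbra_smul (c : ℂ) (ψ : d → ℂ) : ketbra (c • ψ) = (Complex.normSq c : ℂ) • ketbra ψ := by
  ext a b
  simp [ketbra, Matrix.vecMulVec_apply, Complex.normSq_eq_conj_mul_self]
  ring

theorem prob_smul (M : Matrix d d ℂ) (c : ℂ) (ψ : d → ℂ) :
    prob M (c • ψ) = Complex.normSq c * prob M ψ := by
  have : star (c • ψ) ⬝ᵥ M.mulVec (c • ψ) = (Complex.normSq c : ℂ) * (star ψ ⬝ᵥ M.mulVec ψ) := by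
    rw [Matrix.mulVec_smul, star_smul, smul_dotProduct, dotProduct_smul, Complex.normSq_eq_conj_mul_self]
    simp [mul_assoc]
  rw [prob, this, Complex.re_ofReal_mul, prob]

theorem prob_nonneg {M : Matrix d d ℂ} (hM : M.PosSemidef) (ψ : d → ℂ) : 0 ≤ prob M ψ :=
  hM.re_dotProduct_nonneg ψ

theorem IsPOVM.sum_prob {M : ι → Matrix d d ℂ} (hM : IsPOVM M) {ψ : d → ℂ} (hψ : IsUnitVector ψ) :
    ∑ i, prob (M i) ψ = 1 := by
  simp only [prob]
  rw [← Complex.re_sum, ← dotProduct_sum, ← Matrix.sum_mulVec, hM.2, Matrix.one_mulVec, hψ,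
    Complex.one_re]

theorem IsPOVM.shannon_nonneg {M : ι → Matrix d d ℂ} (hM : IsPOVM M) {ψ : d → ℂ}
    (hψ : IsUnitVector ψ) : 0 ≤ shannon fun i => prob (M i) ψ := by
  refine Finset.sum_nonneg fun i _ => div_nonneg ?_ (Real.log_nonneg one_le_two)
  refine Real.negMulLog_nonneg (prob_nonneg (hM.1 i) ψ) ?_
  rw [← hM.sum_prob hψ]
  exact Finset.single_le_sum (f := fun i => prob (M i) ψ) (fun i _ => prob_nonneg (hM.1 i) ψ)
    (Finset.mem_univ i)

/-- Concavity of the Shannon entropy. -/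
theorem sum_mul_shannon_le {κ : Type*} [Fintype κ] {w : κ → ℝ} (hw : ∀ k, 0 ≤ w k)
    (hw1 : ∑ k, w k = 1) {p : κ → ι → ℝ} (hp : ∀ k i, 0 ≤ p k i) :
    ∑ k, w k * shannon (p k) ≤ shannon fun i => ∑ k, w k * p k i := by
  simp only [shannon, Finset.mul_sum]
  rw [Finset.sum_comm]
  refine Finset.sum_le_sum fun i _ => ?_
  simp only [← mul_div_assoc]
  rw [← Finset.sum_div]
  refine div_le_div_of_nonneg_right ?_ (Real.log_nonneg one_le_two)
  exact Real.concaveOn_negMulLog.le_map_sum (fun k _ => hw k) hw1 fun k _ => hp k i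

theorem trace_eq_sum_of_eq_sum_ketbra {κ : Type*} [Fintype κ] {ρ : Matrix d d ℂ}
    {w : κ → ℝ} {ψ : κ → d → ℂ} (hψ : ∀ k, IsUnitVector (ψ k))
    (h : ρ = ∑ k, (w k : ℂ) • ketbra (ψ k)) : ρ.trace = ((∑ k, w k : ℝ) : ℂ) := by
  rw [h, Matrix.trace_sum, Complex.ofReal_sum]
  exact Finset.sum_congr rfl fun k _ => by
    rw [Matrix.trace_smul, trace_ketbra, hψ k, smul_eq_mul, mul_one]

/-- A decomposition indexed by a finite type gives one indexed by `Fin k`. -/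
theorem exists_isPureDecomposition_of_fintype {κ : Type*} [Fintype κ] {ρ : Matrix d d ℂ}
    (hρ : IsState ρ) {w : κ → ℝ} {ψ : κ → d → ℂ} (hw : ∀ k, 0 ≤ w k)
    (hψ : ∀ k, IsUnitVector (ψ k)) (h : ρ = ∑ k, (w k : ℂ) • ketbra (ψ k)) :
    ∃ (n : ℕ) (w' : Fin n → ℝ) (ψ' : Fin n → d → ℂ), IsPureDecomposition ρ w' ψ' ∧
      ∀ g : (d → ℂ) → ℝ, ∑ j, w' j * g (ψ' j) = ∑ k, w k * g (ψ k) := by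
  let e := (Fintype.equivFin κ).symm
  have hsum : ∑ k, w k = 1 := by
    have := trace_eq_sum_of_eq_sum_ketbra hψ h
    rw [hρ.2] at this
    exact_mod_cast this.symm
  exact ⟨_, w ∘ e, ψ ∘ e, ⟨fun j => hw _, (e.sum_comp w).trans hsum, fun j => hψ _,
    h.trans (e.sum_comp fun k => (w k : ℂ) • ketbra (ψ k)).symm⟩,
    fun g => e.sum_comp fun k => w k * g (ψ k)⟩

theorem IsState.nonempty {ρ : Matrix d d ℂ} (hρ : IsState ρ) : Nonempty d := by
  by_contra h
  rw [not_nonempty_iff] at h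
  have := hρ.2
  simp [Matrix.trace] at this

theorem exists_isPureDecomposition {ρ : Matrix d d ℂ} (hρ : IsState ρ) :
    ∃ (n : ℕ) (w : Fin n → ℝ) (ψ : Fin n → d → ℂ), IsPureDecomposition ρ w ψ := by
  have := hρ.nonempty
  obtain ⟨r, hr⟩ := exists_eq_mul_conjTranspose hρ.1
  -- The columns of `r`, normalized, decompose `ρ = r r†`.
  choose x u hx hu hxu using fun k => exists_unitVector_smul fun a => r a k
  obtain ⟨n, w, ψ, h, -⟩ := exists_isPureDecomposition_of_fintype hρ
    (fun k => Complex.normSq_nonneg (x k : ℂ)) hu (by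
      simp only [← ketbra_smul, ← hxu]
      rw [hr]
      ext a b
      simp [Matrix.mul_apply, Matrix.sum_apply, ketbra, Matrix.vecMulVec_apply])
  exact ⟨n, w, ψ, h⟩

/-- The trace of `N ρ N†` is a nonnegative combination of the squared norms of the `N ψ j`. Applied
to the complement of a support projection, it places every vector of nonzero weight in the support.
-/
theorem IsPureDecomposition.mulVec_eq_zero {ρ : Matrix d d ℂ} {n : ℕ} {w : Fin n → ℝ}
    {ψ : Fin n → d → ℂ} (h : IsPureDecomposition ρ w ψ) {N : Matrix d d ℂ} (hN : N * ρ = 0)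
    {j : Fin n} (hj : w j ≠ 0) : N.mulVec (ψ j) = 0 := by
  obtain ⟨hw, -, -, hρ⟩ := h
  have h0 : ∑ j, (w j : ℂ) * (star (N.mulVec (ψ j)) ⬝ᵥ N.mulVec (ψ j)) = 0 := by
    have := congrArg Matrix.trace (congrArg (· * N.conjTranspose) hN)
    simpa [hρ, Finset.mul_sum, Finset.sum_mul, ← ketbra_mulVec, Matrix.trace_sum, trace_ketbra]
      using this
  have h1 := (Finset.sum_eq_zero_iff_of_nonneg fun j _ => mul_nonneg
    (Complex.zero_le_real.2 (hw j)) (dotProduct_star_self_nonneg _)).1 h0 j (Finset.mem_univ j)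
  rw [mul_eq_zero, Complex.ofReal_eq_zero, or_iff_right hj] at h1
  exact dotProduct_star_self_eq_zero.1 h1

/-- The support projection `Π` of the ancillary state of an extension of an extremal POVM: the
compression of `P i` by `1 ⊗ Π` is `M i ⊗ Π`. -/
theorem exists_support_projection {M : ι → Matrix d d ℂ} (hM : IsExtremalPOVM M)
    {P : ι → Matrix (d × q) (d × q) ℂ} {σ : Matrix q q ℂ} (h : IsNaimarkExtension M P σ) :
    ∃ S : Matrix q q ℂ, S.IsHermitian ∧ S * σ = σ ∧ ∀ i,
      ((1 : Matrix d d ℂ) ⊗ₖ S) * P i * ((1 : Matrix d d ℂ) ⊗ₖ S) = M i ⊗ₖ S := by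
  have hσ : IsSelfAdjoint σ := h.2.1.1.isHermitian.isSelfAdjoint
  have hc : ∀ f : ℝ → ℝ, ContinuousOn f (spectrum ℝ σ) := fun f =>
    Matrix.finite_real_spectrum.continuousOn f
  -- As `0⁻¹ = 0`, `g` is the pseudoinverse of `σ` and `x * x⁻¹` is the indicator of the nonzero
  -- spectrum.
  set g := cfc (fun x : ℝ => x⁻¹) σ
  set S := cfc (fun x : ℝ => x * x⁻¹) σ
  have hS1 : S = σ * g := by
    simp only [S, g]
    rw [cfc_mul _ _ σ (hc _) (hc _), cfc_id' ℝ σ]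
  have hS2 : S = g * σ := by
    simp only [S, g]
    rw [cfc_congr fun x _ => mul_comm x x⁻¹, cfc_mul _ _ σ (hc _) (hc _), cfc_id' ℝ σ]
  have hSσ : S * σ = σ := by
    calc S * σ = S * cfc (fun x : ℝ => x) σ := by rw [cfc_id' ℝ σ]
      _ = cfc (fun x : ℝ => x * x⁻¹ * x) σ := (cfc_mul _ _ σ (hc _) (hc _)).symm
      _ = cfc (fun x : ℝ => x) σ := cfc_congr fun x _ => by
        rcases eq_or_ne x 0 with rfl | hx
        · simp
        · simp [hx]
      _ = σ := cfc_id' ℝ σ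
  have hSS : S * S = S := by
    nth_rw 2 [hS1]
    rw [← Matrix.mul_assoc, hSσ, hS1]
  refine ⟨S, cfc_predicate _ σ, hSσ, fun i => ?_⟩
  obtain ⟨s, hs⟩ := exists_eq_mul_conjTranspose h.2.1.1
  have hc := compression_eq hM (hs ▸ h) i
  have hl : (1 : Matrix d d ℂ) ⊗ₖ S
      = ((1 : Matrix d d ℂ) ⊗ₖ (g * s)) * ((1 : Matrix d d ℂ) ⊗ₖ s.conjTranspose) := by
    rw [← Matrix.mul_kronecker_mul, Matrix.mul_assoc, ← hs, hS2, Matrix.mul_one]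
  have hr : (1 : Matrix d d ℂ) ⊗ₖ S
      = ((1 : Matrix d d ℂ) ⊗ₖ s) * ((1 : Matrix d d ℂ) ⊗ₖ (s.conjTranspose * g)) := by
    rw [← Matrix.mul_kronecker_mul, ← Matrix.mul_assoc, ← hs, hS1, Matrix.mul_one]
  have hgs : g * s * (s.conjTranspose * s) * (s.conjTranspose * g) = S := by
    rw [← hSS]
    nth_rw 1 [hS2]
    rw [hS1, hs]
    simp only [Matrix.mul_assoc]
  calc _ = ((1 : Matrix d d ℂ) ⊗ₖ (g * s)) * (((1 : Matrix d d ℂ) ⊗ₖ s.conjTranspose) * P i *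
          ((1 : Matrix d d ℂ) ⊗ₖ s)) * ((1 : Matrix d d ℂ) ⊗ₖ (s.conjTranspose * g)) := by
        nth_rw 2 [hr]
        rw [hl]
        simp only [Matrix.mul_assoc]
    _ = _ := by
        rw [hc, ← Matrix.mul_kronecker_mul, ← Matrix.mul_kronecker_mul, hgs, Matrix.one_mul,
          Matrix.mul_one]

theorem prob_kronecker_one (M : Matrix d d ℂ) (Ψ : d × q → ℂ) :
    prob (M ⊗ₖ (1 : Matrix q q ℂ)) Ψ = ∑ k, prob M fun a => Ψ (a, k) := by
  simp only [prob]
  rw [← Complex.re_sum]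
  congr 1
  simp [dotProduct, Matrix.mulVec, Fintype.sum_prod_type, Matrix.kroneckerMap_apply, Matrix.one_apply]
  rw [Finset.sum_comm]

/-- The outcome probabilities of an extension on the pure states that occur in a decomposition of
`ρ ⊗ σ` are those of the POVM. -/
theorem prob_eq_of_isPureDecomposition {M : ι → Matrix d d ℂ} (hM : IsExtremalPOVM M)
    {P : ι → Matrix (d × q) (d × q) ℂ} {σ : Matrix q q ℂ} (h : IsNaimarkExtension M P σ)
    {ρ : Matrix d d ℂ} {n : ℕ} {w : Fin n → ℝ} {Ψ : Fin n → d × q → ℂ}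
    (hΨ : IsPureDecomposition (ρ ⊗ₖ σ) w Ψ) {j : Fin n} (hj : w j ≠ 0) (i : ι) :
    prob (P i) (Ψ j) = ∑ k, prob (M i) fun a => Ψ j (a, k) := by
  obtain ⟨S, hS, hSσ, hSP⟩ := exists_support_projection hM h
  have hT : ((1 : Matrix d d ℂ) ⊗ₖ S).conjTranspose = (1 : Matrix d d ℂ) ⊗ₖ S := by
    rw [Matrix.conjTranspose_kronecker, hS.eq, Matrix.conjTranspose_one]
  have hfix : ((1 : Matrix d d ℂ) ⊗ₖ S).mulVec (Ψ j) = Ψ j := by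
    have := hΨ.mulVec_eq_zero (N := 1 - (1 : Matrix d d ℂ) ⊗ₖ S) (by
      rw [Matrix.sub_mul, ← Matrix.mul_kronecker_mul, hSσ, Matrix.one_mul, Matrix.one_mul, sub_self]) hj
    rw [Matrix.sub_mulVec, Matrix.one_mulVec, sub_eq_zero] at this
    exact this.symm
  rw [← prob_kronecker_one, prob, prob]
  congr 1
  calc star (Ψ j) ⬝ᵥ (P i).mulVec (Ψ j)
      = star (((1 : Matrix d d ℂ) ⊗ₖ S).mulVec (Ψ j)) ⬝ᵥ
          (P i).mulVec (((1 : Matrix d d ℂ) ⊗ₖ S).mulVec (Ψ j)) := by rw [hfix]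
    _ = star (Ψ j) ⬝ᵥ (M i ⊗ₖ S).mulVec (Ψ j) := by
      rw [Matrix.star_mulVec, hT, ← Matrix.dotProduct_mulVec, Matrix.mulVec_mulVec,
        Matrix.mulVec_mulVec, hSP]
    _ = _ := by
      rw [show M i ⊗ₖ S = (M i ⊗ₖ (1 : Matrix q q ℂ)) * ((1 : Matrix d d ℂ) ⊗ₖ S) by
        rw [← Matrix.mul_kronecker_mul, Matrix.mul_one, Matrix.one_mul], ← Matrix.mulVec_mulVec, hfix]

/-- The convex roof of the outcome entropy of a POVM. -/
noncomputable def convexRoof (ρ : Matrix d d ℂ) (M : ι → Matrix d d ℂ) : ℝ :=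
  sInf {r : ℝ | ∃ (k : ℕ) (w : Fin k → ℝ) (ψ : Fin k → d → ℂ), IsPureDecomposition ρ w ψ ∧
    r = ∑ j, w j * shannon fun i => prob (M i) (ψ j)}

theorem partialTraceQ_ketbra (Ψ : d × q → ℂ) :
    partialTraceQ (ketbra Ψ) = ∑ k, ketbra fun a => Ψ (a, k) := by
  ext a b
  simp [partialTraceQ, ketbra, Matrix.vecMulVec_apply, Matrix.sum_apply]

theorem IsState.kronecker {ρ : Matrix d d ℂ} {σ : Matrix q q ℂ} (hρ : IsState ρ) (hσ : IsState σ) :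
    IsState (ρ ⊗ₖ σ) :=
  ⟨hρ.1.kronecker hσ.1, by rw [Matrix.trace_kronecker, hρ.2, hσ.2, one_mul]⟩

/-- The value of `R_c` on every generalized Naimark extension of an extremal POVM. -/
theorem Rc_naimarkExtension {M : ι → Matrix d d ℂ} (hM : IsExtremalPOVM M)
    {P : ι → Matrix (d × q) (d × q) ℂ} {σ : Matrix q q ℂ} (h : IsNaimarkExtension M P σ)
    {ρ : Matrix d d ℂ} (hρ : IsState ρ) :
    Rc (ρ ⊗ₖ σ) P = convexRoof ρ M := by
  have hd := hρ.nonempty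
  have hρσ := hρ.kronecker h.2.1
  have hcost : ∀ {n : ℕ} {w : Fin n → ℝ} {Ψ : Fin n → d × q → ℂ},
      IsPureDecomposition (ρ ⊗ₖ σ) w Ψ →
      ∑ j, w j * vonNeumannEntropy (dephase P (ketbra (Ψ j)))
        = ∑ j, w j * shannon fun i => ∑ k, prob (M i) fun a => Ψ j (a, k) := fun {n w Ψ} hΨ => by
    -- A vector of weight zero need not lie in the support, but it adds nothing to the cost.
    refine Finset.sum_congr rfl fun j _ => ?_
    rcases eq_or_ne (w j) 0 with hj | hj
    · simp [hj]
    · rw [vonNeumannEntropy_dephase_ketbra h.1]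
      simp only [prob_eq_of_isPureDecomposition hM h hΨ hj]
  refine le_antisymm (le_csInf ?_ ?_) (le_csInf ?_ ?_)
  · obtain ⟨n, w, ψ, hψ⟩ := exists_isPureDecomposition hρ
    exact ⟨_, n, w, ψ, hψ, rfl⟩
  · rintro _ ⟨n, w, ψ, hψ, rfl⟩
    refine csInf_le ⟨0, ?_⟩ ?_
    · rintro _ ⟨n, w, Ψ, hΨ, rfl⟩
      refine Finset.sum_nonneg fun j _ => mul_nonneg (hΨ.1 j) ?_
      rw [vonNeumannEntropy_dephase_ketbra h.1]
      exact h.1.1.shannon_nonneg (hΨ.2.2.1 j)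
    -- Products `ψ j ⊗ φ l`, with `φ` decomposing `σ`, have the outcome probabilities of `ψ j`,
    -- hence the same cost.
    · obtain ⟨m, v, φ, hφ⟩ := exists_isPureDecomposition h.2.1
      have hket : ∀ j l, ketbra (fun x : d × q => ψ j x.1 * φ l x.2)
          = ketbra (ψ j) ⊗ₖ ketbra (φ l) := fun j l => by
        ext ⟨a, k⟩ ⟨b, k'⟩
        simp [ketbra, Matrix.vecMulVec_apply, Matrix.kroneckerMap_apply]
        ring
      obtain ⟨N, w', Ψ, hΨ, hg⟩ := exists_isPureDecomposition_of_fintype hρσ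
        (κ := Fin n × Fin m) (w := fun x => w x.1 * v x.2)
        (ψ := fun x y => ψ x.1 y.1 * φ x.2 y.2) (fun x => mul_nonneg (hψ.1 _) (hφ.1 _))
        (fun x => by
          rw [IsUnitVector, ← trace_ketbra, hket, Matrix.trace_kronecker, trace_ketbra, trace_ketbra,
            hψ.2.2.1, hφ.2.2.1, one_mul])
        (by
          conv_lhs => rw [hψ.2.2.2, hφ.2.2.2]
          ext ⟨a, k⟩ ⟨b, k'⟩
          simp [hket, Matrix.sum_apply, Matrix.kroneckerMap_apply, Fintype.sum_prod_type,
            Finset.sum_mul_sum]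
          refine Finset.sum_congr rfl fun _ _ => Finset.sum_congr rfl fun _ _ => ?_
          ring)
      refine ⟨N, w', Ψ, hΨ, ?_⟩
      rw [hcost hΨ, hg fun Ψ => shannon fun i => ∑ k, prob (M i) fun a => Ψ (a, k)]
      have hp : ∀ j l i, ∑ k, prob (M i) (fun a => ψ j a * φ l k) = prob (M i) (ψ j) := fun j l i => by
        have h1 : ∑ k, Complex.normSq (φ l k) = 1 := by
          have := hφ.2.2.1 l
          rw [IsUnitVector, dotProduct] at this
          simp only [Pi.star_apply, Complex.star_def, ← Complex.normSq_eq_conj_mul_self] at this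
          exact_mod_cast this
        have h2 : ∀ k, (fun a => ψ j a * φ l k) = φ l k • ψ j := fun k => by
          ext a; simp [mul_comm]
        simp only [h2, prob_smul]
        rw [← Finset.sum_mul, h1, one_mul]
      simp only [hp, Fintype.sum_prod_type]
      refine Finset.sum_congr rfl fun j _ => ?_
      rw [← Finset.sum_mul, ← Finset.mul_sum, hφ.2.1, mul_one]
  · obtain ⟨n, w, ψ, hψ⟩ := exists_isPureDecomposition hρσ
    exact ⟨_, n, w, ψ, hψ, rfl⟩
  · rintro _ ⟨n, w, Ψ, hΨ, rfl⟩
    rw [hcost hΨ]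
    -- The slices of `Ψ j` along the ancilla basis, normalized, decompose `tr_Q (ρ ⊗ σ) = ρ`; by
    -- concavity this refinement does not raise the cost.
    choose x u hx hu hxu using fun j k => exists_unitVector_smul fun a => Ψ j (a, k)
    have hx1 : ∀ j, ∑ k, Complex.normSq (x j k) = 1 := fun j => by
      have h1 := congrArg Matrix.trace (partialTraceQ_ketbra (Ψ j))
      have h2 : (partialTraceQ (ketbra (Ψ j))).trace = (ketbra (Ψ j)).trace := by
        simp [partialTraceQ, Matrix.trace, Fintype.sum_prod_type]
      rw [h2, trace_ketbra, hΨ.2.2.1 j, Matrix.trace_sum] at h1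
      simp only [hxu, ketbra_smul, Matrix.trace_smul, trace_ketbra, fun j k => show star (u j k) ⬝ᵥ u j k = 1 from hu j k,
        smul_eq_mul, mul_one] at h1
      exact_mod_cast h1.symm
    obtain ⟨N, w', ψ, hψ, hg⟩ := exists_isPureDecomposition_of_fintype hρ (κ := Fin n × q)
      (w := fun y => w y.1 * Complex.normSq (x y.1 y.2)) (ψ := fun y => u y.1 y.2)
      (fun y => mul_nonneg (hΨ.1 _) (Complex.normSq_nonneg _)) (fun y => hu _ _) (by
        have h1 := partialTraceQ_kronecker ρ σ
        rw [h.2.1.2, one_smul, hΨ.2.2.2, partialTraceQ_sum] at h1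
        simp only [partialTraceQ_smul, partialTraceQ_ketbra, hxu, ketbra_smul, Finset.smul_sum,
          smul_smul] at h1
        rw [← h1, Fintype.sum_prod_type]
        simp only [Complex.ofReal_mul])
    have hle : convexRoof ρ M ≤ ∑ j, w' j * shannon fun i => prob (M i) (ψ j) := by
      refine csInf_le ⟨0, ?_⟩ ⟨N, w', ψ, hψ, rfl⟩
      rintro _ ⟨n, w, ψ, hψ, rfl⟩
      exact Finset.sum_nonneg fun j _ => mul_nonneg (hψ.1 j) (hM.1.shannon_nonneg (hψ.2.2.1 j))
    refine hle.trans ?_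
    rw [hg fun ψ => shannon fun i => prob (M i) ψ, Fintype.sum_prod_type]
    refine Finset.sum_le_sum fun j _ => ?_
    simp only [mul_assoc, ← Finset.mul_sum, hxu, prob_smul]
    exact mul_le_mul_of_nonneg_left (sum_mul_shannon_le (fun k => Complex.normSq_nonneg _) (hx1 j)
      fun k i => prob_nonneg (hM.1.1 i) _) (hΨ.1 j)

theorem randomness_eq_of_naimarkExtension {q₁ q₂ : Type*} [Fintype q₁] [DecidableEq q₁] [Fintype q₂]
    [DecidableEq q₂] {M : ι → Matrix d d ℂ} (hM : IsExtremalPOVM M) {ρ : Matrix d d ℂ}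
    (hρ : IsState ρ) (R : RandomnessKind) {P₁ : ι → Matrix (d × q₁) (d × q₁) ℂ}
    {σ₁ : Matrix q₁ q₁ ℂ} {P₂ : ι → Matrix (d × q₂) (d × q₂) ℂ} {σ₂ : Matrix q₂ q₂ ℂ}
    (h₁ : IsNaimarkExtension M P₁ σ₁) (h₂ : IsNaimarkExtension M P₂ σ₂) :
    randomness R (ρ ⊗ₖ σ₁) P₁ = randomness R (ρ ⊗ₖ σ₂) P₂ := by
  cases R with
  | c => exact (Rc_naimarkExtension hM h₁ hρ).trans (Rc_naimarkExtension hM h₂ hρ).symm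
  | q =>
    obtain ⟨r, rfl⟩ := exists_eq_mul_conjTranspose hρ.1
    exact (Rq_naimarkExtension hM h₁ hρ).trans (Rq_naimarkExtension hM h₂ hρ).symm

/-! ### Canonical extensions and relabelling of the ancilla. -/

variable [DecidableEq ι]

theorem isState_ketbra_ket (i : ι) : IsState (ketbra (ket i)) := by
  refine ⟨Matrix.posSemidef_vecMulVec_self_star _, ?_⟩
  rw [trace_ketbra]
  simp [ket]

theorem sum_ketbra_ket : ∑ i : ι, ketbra (ket i) = 1 := by
  ext k l
  simp [Matrix.sum_apply, ketbra, ket, Matrix.vecMulVec_apply, Pi.single_apply, Matrix.one_apply]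

theorem ketbra_ket_mul_self (i : ι) : ketbra (ket i) * ketbra (ket i) = ketbra (ket i) := by
  rw [ketbra, Matrix.vecMulVec_mul_vecMulVec]
  simp [ket]

theorem IsCanonicalExtension.isNaimarkExtension {M : ι → Matrix d d ℂ} {i₀ : ι}
    {P : ι → Matrix (d × ι) (d × ι) ℂ} (h : IsCanonicalExtension M i₀ P) :
    IsNaimarkExtension M P (ketbra (ket i₀)) := by
  obtain ⟨⟨U, hU, hP⟩, hM⟩ := h
  refine ⟨⟨⟨fun i => ?_, ?_⟩, fun i => ?_⟩, isState_ketbra_ket i₀, hM⟩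
  · rw [hP]
    exact (Matrix.PosSemidef.one.kronecker (isState_ketbra_ket i).1).conjTranspose_mul_mul_same U
  · simp only [hP]
    rw [← Finset.sum_mul, ← Finset.mul_sum]
    have : ∑ i : ι, (1 : Matrix d d ℂ) ⊗ₖ ketbra (ket i) = 1 := by
      rw [← Matrix.one_kronecker_one, ← sum_ketbra_ket (ι := ι)]
      ext ⟨a, k⟩ ⟨b, l⟩
      simp only [Matrix.sum_apply, Matrix.kroneckerMap_apply, Finset.mul_sum]
    rw [this, Matrix.mul_one, Matrix.mem_unitaryGroup_iff'.1 hU]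
  · rw [hP]
    have hU' := Matrix.mem_unitaryGroup_iff.1 hU
    calc _ = star U * ((1 : Matrix d d ℂ) ⊗ₖ ketbra (ket i)) * (U * star U)
          * ((1 : Matrix d d ℂ) ⊗ₖ ketbra (ket i)) * U := by simp only [Matrix.mul_assoc]
      _ = _ := by
        rw [hU', Matrix.mul_one, Matrix.mul_assoc (star U), ← Matrix.mul_kronecker_mul,
          ketbra_ket_mul_self, Matrix.one_mul]

theorem partialTraceQ_mul_ketbra_ket (X : Matrix (d × ι) (d × ι) ℂ) (i₀ : ι) :
    partialTraceQ (X * ((1 : Matrix d d ℂ) ⊗ₖ ketbra (ket i₀)))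
      = X.submatrix (fun a => (a, i₀)) fun a => (a, i₀) := by
  ext a b
  simp [partialTraceQ, mul_one_kronecker_apply, ketbra, ket, Matrix.vecMulVec_apply, Pi.single_apply]

/-- Naimark's theorem, with the ancilla labelled by the outcomes. -/
theorem IsPOVM.exists_isCanonicalExtension {M : ι → Matrix d d ℂ} (hM : IsPOVM M) (i₀ : ι) :
    ∃ P, IsCanonicalExtension M i₀ P := by
  choose r hr using fun i => exists_eq_mul_conjTranspose (hM.1 i)
  -- With `M i = r i (r i)†`, these are the images of `|a⟩` under the isometry `|a⟩ ↦ ∑ i, (r i)†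
  -- |a⟩ ⊗ |i⟩`. They ignore the second index, so only the slice at `i₀` is orthonormal; completing
  -- it to a basis gives the columns of `U`.
  let v : d × ι → EuclideanSpace ℂ (d × ι) := fun x =>
    WithLp.toLp 2 fun y => (r y.2).conjTranspose y.1 x.1
  have hinner : ∀ x y, inner ℂ (v x) (v y) = (1 : Matrix d d ℂ) x.1 y.1 := fun x y => by
    rw [EuclideanSpace.inner_eq_star_dotProduct, ← hM.2, Matrix.sum_apply, dotProduct_comm, dotProduct,
      Fintype.sum_prod_type, Finset.sum_comm]
    refine Finset.sum_congr rfl fun i _ => ?_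
    rw [hr i, Matrix.mul_apply]
    simp [v]
  have hv : Orthonormal ℂ (({x | x.2 = i₀} : Set (d × ι)).domRestrict v) := by
    rw [orthonormal_iff_ite]
    rintro ⟨⟨a, i⟩, hi⟩ ⟨⟨b, j⟩, hj⟩
    obtain rfl : i = i₀ := hi
    obtain rfl : j = i := hj
    simp [Set.domRestrict_apply, hinner, Matrix.one_apply]
  obtain ⟨B, hB⟩ := hv.exists_orthonormalBasis_extension_of_card_eq finrank_euclideanSpace
  let U : Matrix (d × ι) (d × ι) ℂ := Matrix.of fun x y => B y x
  have hU : U ∈ Matrix.unitaryGroup (d × ι) ℂ := by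
    rw [Matrix.mem_unitaryGroup_iff']
    ext x y
    have := orthonormal_iff_ite.1 B.orthonormal x y
    rw [EuclideanSpace.inner_eq_star_dotProduct, dotProduct_comm] at this
    simpa [Matrix.mul_apply, U, Matrix.one_apply, dotProduct, Matrix.star_apply] using this
  refine ⟨_, ⟨U, hU, fun i => rfl⟩, fun i => ?_⟩
  rw [partialTraceQ_mul_ketbra_ket, hr i]
  ext a b
  have hUB : ∀ (x : d × ι) (a : d), U x (a, i₀) = (r x.2).conjTranspose x.1 a := fun x a => by
    simp only [U, Matrix.of_apply, hB (a, i₀) rfl, v]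
  have hmul : ∀ (x : d × ι) (a : d), (((1 : Matrix d d ℂ) ⊗ₖ ketbra (ket i)) * U) x (a, i₀)
      = if x.2 = i then (r i).conjTranspose x.1 a else 0 := by
    rintro ⟨c, k⟩ a
    rw [one_kronecker_mul_apply]
    simp only [hUB]
    by_cases hk : k = i <;>
      simp [ketbra, ket, Matrix.vecMulVec_apply, Pi.single_apply, hk]
  rw [Matrix.submatrix_apply, Matrix.mul_assoc, Matrix.mul_apply, Matrix.mul_apply]
  simp [hmul, Fintype.sum_prod_type, Matrix.star_apply, hUB]

/-- Relabelling the basis of the ancilla. -/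
theorem IsNaimarkExtension.reindex {q' : Type*} [Fintype q'] [DecidableEq q'] (e : q ≃ q')
    {M : ι → Matrix d d ℂ} {P : ι → Matrix (d × q) (d × q) ℂ} {σ : Matrix q q ℂ}
    (h : IsNaimarkExtension M P σ) :
    IsNaimarkExtension M (fun i => (P i).submatrix (Prod.map id e.symm) (Prod.map id e.symm))
      (σ.submatrix e.symm e.symm) := by
  have he : Prod.map id e.symm = ((Equiv.refl d).prodCongr e.symm : d × q' → d × q) := rfl
  obtain ⟨⟨⟨hP1, hP2⟩, hP3⟩, ⟨hσ1, hσ2⟩, hM⟩ := h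
  refine ⟨⟨⟨fun i => (hP1 i).submatrix _, ?_⟩, fun i => ?_⟩, ⟨hσ1.submatrix _, ?_⟩, fun i => ?_⟩
  · have hsum : ∀ f : d × q' → d × q, ∑ i, (P i).submatrix f f = (∑ i, P i).submatrix f f := fun f => by
      ext; simp [Matrix.sum_apply]
    rw [hsum, hP2, he, Matrix.submatrix_one_equiv]
  · rw [he, Matrix.submatrix_mul_equiv, hP3]
  · rw [← hσ2]; exact e.symm.sum_comp fun k => σ k k
  · rw [hM i]
    ext a b
    simp only [partialTraceQ, Matrix.of_apply, mul_one_kronecker_apply]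
    rw [← e.symm.sum_comp]
    refine Finset.sum_congr rfl fun k _ => ?_
    rw [← e.symm.sum_comp]
    rfl

end

end QRand

/-! ### The main theorem. -/

theorem theorem1 {d ι : Type*} [Fintype d] [DecidableEq d] [Fintype ι] [DecidableEq ι]
    (M : ι → Matrix d d ℂ) (hM : QRand.IsExtremalPOVM M)
    (ρ : Matrix d d ℂ) (hρ : QRand.IsState ρ) (R : QRand.RandomnessKind) :
    (∀ {q₁ q₂ : Type*} [Fintype q₁] [DecidableEq q₁] [Fintype q₂] [DecidableEq q₂]
      (P₁ : ι → Matrix (d × q₁) (d × q₁) ℂ) (σ₁ : Matrix q₁ q₁ ℂ)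
      (P₂ : ι → Matrix (d × q₂) (d × q₂) ℂ) (σ₂ : Matrix q₂ q₂ ℂ),
      QRand.IsNaimarkExtension M P₁ σ₁ → QRand.IsNaimarkExtension M P₂ σ₂ →
      QRand.randomness R (ρ ⊗ₖ σ₁) P₁ = QRand.randomness R (ρ ⊗ₖ σ₂) P₂) ∧
    ∀ i₀ : ι,
      (∃ Pc, QRand.IsCanonicalExtension M i₀ Pc) ∧
      ∀ Pc, QRand.IsCanonicalExtension M i₀ Pc →
        QRand.IsNaimarkExtension M Pc (QRand.ketbra (QRand.ket i₀)) ∧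
        IsLeast (QRand.extensionValues R ρ M)
          (QRand.randomness R (ρ ⊗ₖ QRand.ketbra (QRand.ket i₀)) Pc) ∧
        QRand.intrinsicRandomness R ρ M =
          QRand.randomness R (ρ ⊗ₖ QRand.ketbra (QRand.ket i₀)) Pc := by
  refine ⟨fun P₁ σ₁ P₂ σ₂ h₁ h₂ => QRand.randomness_eq_of_naimarkExtension hM hρ R h₁ h₂,
    fun i₀ => ⟨hM.1.exists_isCanonicalExtension i₀, fun Pc hPc => ?_⟩⟩
  have hN := hPc.isNaimarkExtension
  have hN' := hN.reindex (Fintype.equivFin ι)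
  have hleast : IsLeast (QRand.extensionValues R ρ M)
      (QRand.randomness R (ρ ⊗ₖ QRand.ketbra (QRand.ket i₀)) Pc) := by
    -- The admissible values use ancillas indexed by `Fin n`, so membership goes through the
    -- relabelled extension; independence of the extension gives equality of values, hence also
    -- minimality.
    refine ⟨⟨_, _, _, hN', QRand.randomness_eq_of_naimarkExtension hM hρ R hN hN'⟩, ?_⟩
    rintro _ ⟨n, P, σ, h, rfl⟩
    exact (QRand.randomness_eq_of_naimarkExtension hM hρ R hN h).le
  exact ⟨hN, hleast, hleast.csInf_eq⟩
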